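/- Let $n\ge 2$ and $0\le\alpha<n$. For a cube $J\subset\mathbb R^n$ with center $c_J$ and side length $|J|^{1/n}$, let $\gamma J$ be its concentric dilate, and for positive Borel measures $\omega,\mu$ on $\mathbb R^n$ put $$\mathsf E(J,\omega)^2=\mathbb E_J^{d\omega(x)}\mathbb E_J^{d\omega(z)}\left|\frac{x-z}{|J|^{1/n}}\right|^2,\qquad \mathrm P^\alpha(J,\mu)=\int_{\mathbb R^n}\frac{|J|^{1/n}}{\left(|J|^{1/n}+|y-c_J|\right)^{n+1-\alpha}}\,d\mu(y),$$ where $\mathbb E_J^{d\omega}$ is the average over $J$ with respect to $\omega$. Let $\mathcal K$ be the class of all finite vectors $\mathbf T^\alpha=\{T^\alpha_\ell\}_{\ell=1}^N$ of convolution operators $T_\ell^\alpha\mu(x)=\int K_\ell^\alpha(x-y)\,d\mu(y)$ with kernels $$K_\ell^\alpha(w)=\frac{\Omega_\ell(w/|w|)}{|w|^{n-\alpha}},$$ where each $\Omega_\ell$ is a real-valued $C^\infty$ function on $\mathbb S^{n-1}$ with vanishing integral on every great circle of $\mathbb S^{n-1}$ (the intersections of $\mathbb S^{n-1}$ with the planes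 through the origin); in particular this includes all such vectors in which each $K^\alpha_\ell$ is odd. For $C_0>0$ consider the energy reversal inequality $$\mathsf E(J,\omega)^2\,\mathrm P^\alpha(J,\mu)^2\le C_0\,\mathbb E_J^{d\omega(x)}\mathbb E_J^{d\omega(z)}\left|\mathbf T^\alpha\mu(x)-\mathbf T^\alpha\mu(z)\right|^2.\qquad(*)$$ There are finite positive Borel measures $\nu_\gamma$ on $\mathbb R^n$ ($\gamma>2$), depending only on $n$, $\alpha$ and $\gamma$, such that for every cube $J$ the images $\mu_\gamma=\mu_{\gamma,J}$ of $\nu_\gamma$ under $y\mapsto c_J+|J|^{1/n}y$ have the following properties. (0) For every $\gamma>2$ the measure $\mu_\gamma$ is supported outside $\gamma J$. (1) For every $C_0>0$ and all sufficiently large $\gamma$ (depending on $C_0$, but not on the operators), strong reversal of energy fails with the measure $\mu=\mu_\gamma$ simultaneously for all vectors in $\mathcal K$: for every $\mathbf T^\alpha\in\mathcal K$ there is a finite positive Borel measure $\omega$ with $\omega(J)>0$ for which $(*)$ is false. (2) Moreover, there is a single finite positive Borel measure $\omega$ with $\omega(J)>0$ such that for every $C_0>0$ and every $\mathbf T^\alpha\in\mathcal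 K$, the inequality $(*)$ with $\mu=\mu_\gamma$ is false for all sufficiently large $\gamma$ (depending on $C_0$ and $\mathbf T^\alpha$); thus no vector in $\mathcal K$ satisfies strong reversal of $\omega$-energy on $J$. -/

import Mathlib

open MeasureTheory
open scoped ENNReal

noncomputable section

namespace EnergyReversal

/-- A (closed, nondegenerate) cube in `ℝⁿ`: a center, a positive side length, and an orthonormal
basis giving the directions of its edges. -/
structure Cube (n : ℕ) where
  center : EuclideanSpace ℝ (Fin n)
  side : ℝ
  side_pos : 0 < side
  axes : OrthonormalBasis (Fin n) ℝ (EuclideanSpace ℝ (Fin n))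

/-- The concentric dilate `γJ`. -/
def Cube.dilate {n : ℕ} (J : Cube n) (γ : ℝ) : Set (EuclideanSpace ℝ (Fin n)) :=
  {x | ∀ i, |inner ℝ (J.axes i) (x - J.center)| ≤ γ * J.side / 2}

/-- The set of points of the cube `J`. -/
def Cube.carrier {n : ℕ} (J : Cube n) : Set (EuclideanSpace ℝ (Fin n)) :=
  J.dilate 1

/-- The image of a measure under `y ↦ c_J + ℓ(J) y`: a copy of the measure in the position and at
the scale of `J`. -/
def Cube.place {n : ℕ} (J : Cube n) (ν : Measure (EuclideanSpace ℝ (Fin n))) :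
    Measure (EuclideanSpace ℝ (Fin n)) :=
  ν.map (fun y => J.center + J.side • y)

/-- The convolution kernel `K(w) = Ω(w/|w|) / |w|^(n-α)`. Only the values of `Ω` on the unit sphere
matter. -/
def kernel {n : ℕ} (α : ℝ) (Ω : EuclideanSpace ℝ (Fin n) → ℝ)
    (w : EuclideanSpace ℝ (Fin n)) : ℝ :=
  Ω (‖w‖⁻¹ • w) / ‖w‖ ^ ((n : ℝ) - α)

/-- `Ω` is smooth on the unit sphere: its extension, homogeneous of degree zero, is `C^∞` off the
origin. -/
def SmoothOnSphere {n : ℕ} (Ω : EuclideanSpace ℝ (Fin n) → ℝ) : Prop :=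
  ContDiffOn ℝ ((⊤ : ℕ∞) : WithTop ℕ∞) (fun w => Ω (‖w‖⁻¹ • w)) {0}ᶜ

/-- `Ω` has vanishing integral on every great circle (the intersection of the unit sphere with a
plane through the origin). -/
def VanishesOnGreatCircles {n : ℕ} (Ω : EuclideanSpace ℝ (Fin n) → ℝ) : Prop :=
  ∀ u v : EuclideanSpace ℝ (Fin n), ‖u‖ = 1 → ‖v‖ = 1 → inner ℝ u v = 0 →
    ∫ θ in (0 : ℝ)..(2 * Real.pi), Ω (Real.cos θ • u + Real.sin θ • v) = 0

/-- The kernel `K` is odd. -/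
def OddKernel {n : ℕ} (α : ℝ) (Ω : EuclideanSpace ℝ (Fin n) → ℝ) : Prop :=
  ∀ w : EuclideanSpace ℝ (Fin n), kernel α Ω (-w) = -kernel α Ω w

/-- The vector `𝐓μ(x) = (∫ K_ℓ(x - y) dμ(y))_ℓ`. -/
def transform {n N : ℕ} (α : ℝ) (Ω : Fin N → EuclideanSpace ℝ (Fin n) → ℝ)
    (μ : Measure (EuclideanSpace ℝ (Fin n))) (x : EuclideanSpace ℝ (Fin n)) :
    EuclideanSpace ℝ (Fin N) :=
  WithLp.toLp 2 fun l => ∫ y, kernel α (Ω l) (x - y) ∂μ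

/-- The square `E(J,ω)²` of the energy; `⨍⁻` is the `ω`-average, and `|J|^(1/n)` is the side. -/
def energySq {n : ℕ} (J : Cube n) (ω : Measure (EuclideanSpace ℝ (Fin n))) : ℝ≥0∞ :=
  ⨍⁻ x in J.carrier, ⨍⁻ z in J.carrier, ‖J.side⁻¹ • (x - z)‖ₑ ^ 2 ∂ω ∂ω

/-- The fractional Poisson integral
`P^α(J,μ) = ∫ |J|^(1/n) / (|J|^(1/n) + |y - c_J|)^(n+1-α) dμ(y)`. -/
def poisson {n : ℕ} (α : ℝ) (J : Cube n) (μ : Measure (EuclideanSpace ℝ (Fin n))) : ℝ≥0∞ :=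
  ∫⁻ y, ENNReal.ofReal (J.side / (J.side + ‖y - J.center‖) ^ ((n : ℝ) + 1 - α)) ∂μ

/-- The energy reversal inequality
`E(J,ω)² P^α(J,μ)² ≤ C₀ 𝔼_J^{dω(x)} 𝔼_J^{dω(z)} |𝐓μ(x) - 𝐓μ(z)|²`. -/
def ReversalInequality {n N : ℕ} (α C₀ : ℝ) (J : Cube n)
    (Ω : Fin N → EuclideanSpace ℝ (Fin n) → ℝ)
    (ω μ : Measure (EuclideanSpace ℝ (Fin n))) : Prop :=
  energySq J ω * poisson α J μ ^ 2 ≤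
    ENNReal.ofReal C₀ *
      ⨍⁻ x in J.carrier, ⨍⁻ z in J.carrier,
        ‖transform α Ω μ x - transform α Ω μ z‖ₑ ^ 2 ∂ω ∂ω

end EnergyReversal

end

noncomputable section

namespace EnergyReversal

/-! Atoms are placed in a plane so that the potentials at the two points `±e₁/2` agree exactly. Fix
slopes `s_k = sinh (2kh)`. The line from `e₁/2` in direction `s_j e₁ + e₂` and the line from `-e₁/2`
in direction `s_{j+1} e₁ + e₂` meet at height `v_j = 1 / (s_{j+1} - s_j)`; the `j`-th atom sits
there with mass `v_j^(n-α)`. By homogeneity this mass cancels the distance factor, so both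
potentials are the same sum of `K(-(s_k e₁ + e₂))` over `k ∈ ℤ`, shifted by one index
(`transform_place_atomicMeasure_eq`).

For `ω` the sum of unit masses at the two image points in `J`, the right side of the inequality is
therefore zero for every `C₀`, while energy and Poisson integral are positive. The atoms lie on an
ellipse with foci `±e₁/2` and semi-minor axis `R`, hence as far out as desired
(`le_norm_atomPoint`). -/

variable {E : Type*} [NormedAddCommGroup E] [InnerProductSpace ℝ E]

/-! ### Geometry of the atoms -/

/-- The vector `sinh (2kh) e₁ + e₂` in the plane spanned by `e₁` and `e₂`. -/
def slopeVector (e₁ e₂ : E) (h : ℝ) (k : ℤ) : E :=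
  Real.sinh (2 * k * h) • e₁ + e₂

/-- The height over the line `ℝ e₁` of the `j`-th atom. -/
def atomHeight (R h : ℝ) (j : ℤ) : ℝ :=
  R / Real.cosh ((2 * j + 1) * h)

/-- The position of the `j`-th atom: seen from `e₁ / 2` it lies in the direction
`slopeVector e₁ e₂ h j`, and seen from `-e₁ / 2` in the direction
`slopeVector e₁ e₂ h (j + 1)`. -/
def atomPoint (e₁ e₂ : E) (R h : ℝ) (j : ℤ) : E :=
  (1 / 2 : ℝ) • e₁ + atomHeight R h j • slopeVector e₁ e₂ h j

theorem atomHeight_pos {R : ℝ} (hR : 0 < R) (h : ℝ) (j : ℤ) : 0 < atomHeight R h j :=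
  div_pos hR (Real.cosh_pos _)

/-- With `m = (2j+1)h`, `sinh (m+h) - sinh (m-h) = 2 cosh m sinh h`. The value 1 is the distance
between `±e₁/2`. -/
theorem atomHeight_mul_sinh_sub {R h : ℝ} (hRh : 2 * R * Real.sinh h = 1) (j : ℤ) :
    atomHeight R h j * (Real.sinh (2 * (j + 1 : ℤ) * h) - Real.sinh (2 * j * h)) = 1 := by
  have hc := (Real.cosh_pos ((2 * j + 1) * h)).ne'
  have h1 : (2 * (j + 1 : ℤ) * h : ℝ) = (2 * j + 1) * h + h := by push_cast; ring
  have h2 : (2 * j * h : ℝ) = (2 * j + 1) * h - h := by ring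
  rw [atomHeight, h1, h2, Real.sinh_add, Real.sinh_sub]
  field_simp
  linear_combination Real.cosh ((2 * j + 1) * h) * hRh

theorem half_sub_atomPoint (e₁ e₂ : E) (R h : ℝ) (j : ℤ) :
    (1 / 2 : ℝ) • e₁ - atomPoint e₁ e₂ R h j = -(atomHeight R h j • slopeVector e₁ e₂ h j) := by
  rw [atomPoint]; abel

theorem neg_half_sub_atomPoint (e₁ e₂ : E) {R h : ℝ} (hRh : 2 * R * Real.sinh h = 1) (j : ℤ) :
    (-(1 / 2) : ℝ) • e₁ - atomPoint e₁ e₂ R h j =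
      -(atomHeight R h j • slopeVector e₁ e₂ h (j + 1)) := by
  have key := atomHeight_mul_sinh_sub hRh j
  rw [atomPoint, slopeVector, slopeVector]
  linear_combination (norm := module) key • e₁

theorem norm_sq_smul_add {e₁ e₂ : E} (h₁ : ‖e₁‖ = 1) (h₂ : ‖e₂‖ = 1) (h₁₂ : inner ℝ e₁ e₂ = 0)
    (a b : ℝ) : ‖a • e₁ + b • e₂‖ ^ 2 = a ^ 2 + b ^ 2 := by
  rw [norm_add_sq_real, norm_smul, norm_smul, inner_smul_left, inner_smul_right, h₁, h₂, h₁₂]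
  simp

theorem le_norm_atomPoint {e₁ e₂ : E} (h₁ : ‖e₁‖ = 1) (h₂ : ‖e₂‖ = 1) (h₁₂ : inner ℝ e₁ e₂ = 0)
    {R h : ℝ} (hRh : 2 * R * Real.sinh h = 1) (j : ℤ) :
    R ≤ ‖atomPoint e₁ e₂ R h j‖ := by
  set m : ℝ := (2 * j + 1) * h with hm
  have hc := Real.cosh_pos m
  have h2 : (2 * j * h : ℝ) = m - h := by rw [hm]; ring
  have hv : atomHeight R h j * Real.cosh m = R := by
    rw [atomHeight, ← hm]; field_simp
  -- The coordinates are `R cosh h tanh m` and `R / cosh m`: a point of the ellipse with semi-axes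
  -- `R cosh h ≥ R`.
  have hpt : atomPoint e₁ e₂ R h j =
      (atomHeight R h j * Real.sinh m * Real.cosh h) • e₁ + atomHeight R h j • e₂ := by
    rw [atomPoint, slopeVector, h2, Real.sinh_sub]
    have : atomHeight R h j * Real.cosh m * Real.sinh h = 1 / 2 := by
      rw [hv]; linarith
    linear_combination (norm := module) -this • e₁
  refine (le_abs_self R).trans (abs_le_of_sq_le_sq ?_ (norm_nonneg _))
  have hR2 : R ^ 2 = atomHeight R h j ^ 2 * (Real.sinh m ^ 2 + 1) := by
    rw [← Real.cosh_sq, ← mul_pow, hv]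
  have hch : (atomHeight R h j * Real.sinh m * Real.cosh h) ^ 2 =
      (atomHeight R h j * Real.sinh m) ^ 2 * (Real.sinh h ^ 2 + 1) := by
    rw [mul_pow, Real.cosh_sq h]
  rw [hpt, norm_sq_smul_add h₁ h₂ h₁₂, hR2, hch]
  have : 0 ≤ (atomHeight R h j * Real.sinh m) ^ 2 * Real.sinh h ^ 2 := by positivity
  linarith

theorem norm_slopeVector {e₁ e₂ : E} (h₁ : ‖e₁‖ = 1) (h₂ : ‖e₂‖ = 1) (h₁₂ : inner ℝ e₁ e₂ = 0)
    (h : ℝ) (k : ℤ) : ‖slopeVector e₁ e₂ h k‖ = Real.cosh (2 * k * h) := by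
  rw [← sq_eq_sq₀ (norm_nonneg _) (Real.cosh_pos _).le, slopeVector]
  have := norm_sq_smul_add h₁ h₂ h₁₂ (Real.sinh (2 * k * h)) 1
  rw [one_smul] at this
  rw [this, Real.cosh_sq]; ring

/-! ### Exponential decay and summability -/

theorem summable_exp_neg_mul_abs_int {c : ℝ} (hc : 0 < c) :
    Summable fun j : ℤ => Real.exp (-(c * |(j : ℝ)|)) := by
  have hs : Summable fun k : ℕ => Real.exp (-(c * |((k : ℤ) : ℝ)|)) := by
    have : (fun k : ℕ => Real.exp (-(c * |((k : ℤ) : ℝ)|))) =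
        fun k : ℕ => Real.exp (k * -c) := by
      funext k; simp [mul_comm]
    rw [this, Real.summable_exp_nat_mul_iff]
    linarith
  exact Summable.of_nat_of_neg hs (by simpa using hs)

theorem inv_cosh_le (x : ℝ) : (Real.cosh x)⁻¹ ≤ 2 * Real.exp (-|x|) := by
  rw [inv_le_iff_one_le_mul₀ (Real.cosh_pos _), ← Real.cosh_abs, Real.cosh_eq]
  have h1 : Real.exp (-|x|) * Real.exp |x| = 1 := by rw [← Real.exp_add]; simp
  nlinarith [Real.exp_pos (-|x|)]

/-- Needed with `b = 1` for the heights of the atoms and with `b = 0` for the lengths of the slope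
vectors. -/
theorem summable_inv_cosh_rpow {s h : ℝ} (hs : 0 < s) (hh : 0 < h) (b : ℝ) (hb : |b| ≤ 1) :
    Summable fun j : ℤ => ((Real.cosh ((2 * j + b) * h))⁻¹) ^ s := by
  refine Summable.of_nonneg_of_le (fun j => ?_) (fun j => ?_)
    ((summable_exp_neg_mul_abs_int (mul_pos hs hh)).mul_left (2 ^ s))
  · exact Real.rpow_nonneg (inv_nonneg.2 (Real.cosh_pos _).le) _
  · have hj : |(j : ℝ)| ≤ |2 * (j : ℝ) + b| := by
      rcases eq_or_ne j 0 with rfl | hj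
      · simp
      · have h1 : (1 : ℝ) ≤ |(j : ℝ)| := by exact_mod_cast Int.one_le_abs hj
        have h2 := abs_sub_abs_le_abs_sub (2 * (j : ℝ)) (-b)
        rw [abs_neg, abs_mul, abs_two, sub_neg_eq_add] at h2
        linarith
    calc ((Real.cosh ((2 * j + b) * h))⁻¹) ^ s
        ≤ (2 * Real.exp (-|(2 * (j : ℝ) + b) * h|)) ^ s :=
          Real.rpow_le_rpow (inv_nonneg.2 (Real.cosh_pos _).le) (inv_cosh_le _) hs.le
      _ = 2 ^ s * Real.exp (-(s * (|2 * (j : ℝ) + b| * h))) := by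
          rw [Real.mul_rpow zero_le_two (Real.exp_pos _).le, ← Real.exp_mul, abs_mul,
            abs_of_pos hh]
          ring_nf
      _ ≤ 2 ^ s * Real.exp (-(s * h * |(j : ℝ)|)) := by
          refine mul_le_mul_of_nonneg_left (Real.exp_le_exp.2 ?_) (by positivity)
          nlinarith [mul_le_mul_of_nonneg_left hj (mul_pos hs hh).le]

theorem summable_atomHeight_rpow {s R h : ℝ} (hs : 0 < s) (hR : 0 < R) (hh : 0 < h) :
    Summable fun j : ℤ => atomHeight R h j ^ s := by
  refine ((summable_inv_cosh_rpow hs hh 1 (by simp)).mul_left (R ^ s)).congr fun j => ?_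
  rw [atomHeight, div_eq_mul_inv, Real.mul_rpow hR.le (inv_nonneg.2 (Real.cosh_pos _).le)]

/-! ### Homogeneous kernels -/

variable {n : ℕ}

/-- The kernel is positively homogeneous of degree `-(n - α)`. -/
theorem kernel_smul (α : ℝ) (Ω : EuclideanSpace ℝ (Fin n) → ℝ) {t : ℝ} (ht : 0 < t)
    (w : EuclideanSpace ℝ (Fin n)) :
    kernel α Ω (t • w) = kernel α Ω w / t ^ ((n : ℝ) - α) := by
  have hdir : ‖t • w‖⁻¹ • t • w = ‖w‖⁻¹ • w := by
    rw [norm_smul, Real.norm_of_nonneg ht.le, smul_smul, mul_inv, mul_right_comm,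
      inv_mul_cancel₀ ht.ne', one_mul]
  rw [kernel, kernel, hdir, norm_smul, Real.norm_of_nonneg ht.le,
    Real.mul_rpow ht.le (norm_nonneg _), div_div, mul_comm]

theorem SmoothOnSphere.exists_bound {Ω : EuclideanSpace ℝ (Fin n) → ℝ} (hΩ : SmoothOnSphere Ω) :
    ∃ B : ℝ, ∀ w, w ≠ 0 → |Ω (‖w‖⁻¹ • w)| ≤ B := by
  have hcont : ContinuousOn (fun w => Ω (‖w‖⁻¹ • w))
      (Metric.sphere (0 : EuclideanSpace ℝ (Fin n)) 1) :=
    hΩ.continuousOn.mono fun w hw h0 => by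
      rw [Set.mem_singleton_iff] at h0
      simp [h0] at hw
  obtain ⟨B, hB⟩ := (isCompact_sphere _ _).exists_bound_of_continuousOn hcont
  refine ⟨B, fun w hw => ?_⟩
  have hu : ‖‖w‖⁻¹ • w‖ = 1 := by
    rw [norm_smul, norm_inv, norm_norm, inv_mul_cancel₀ (norm_ne_zero_iff.2 hw)]
  simpa [hu] using hB (‖w‖⁻¹ • w) (by simpa using hu)

/-- Seen through a kernel with bounded angular part, the directions `slopeVector e₁ e₂ h k` carry a
summable family of values. -/
theorem summable_kernel_slopeVector {α : ℝ} (hα : α < n) {Ω : EuclideanSpace ℝ (Fin n) → ℝ}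
    (hΩ : SmoothOnSphere Ω) {e₁ e₂ : EuclideanSpace ℝ (Fin n)} (h₁ : ‖e₁‖ = 1) (h₂ : ‖e₂‖ = 1)
    (h₁₂ : inner ℝ e₁ e₂ = 0) {h t : ℝ} (hh : 0 < h) (ht : 0 < t) :
    Summable fun k : ℤ => kernel α Ω (t • -slopeVector e₁ e₂ h k) := by
  obtain ⟨B, hB⟩ := hΩ.exists_bound
  have hs : 0 < (n : ℝ) - α := by linarith
  refine Summable.of_norm_bounded
    ((summable_inv_cosh_rpow hs hh 0 (by simp)).mul_left (B / t ^ ((n : ℝ) - α))) fun k => ?_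
  have hn : ‖-slopeVector e₁ e₂ h k‖ = Real.cosh ((2 * k + 0) * h) := by
    rw [norm_neg, norm_slopeVector h₁ h₂ h₁₂, add_zero]
  have hc := Real.cosh_pos ((2 * k + 0) * h)
  have h0 : -slopeVector e₁ e₂ h k ≠ 0 := norm_pos_iff.1 (hn ▸ hc)
  have hcs := Real.rpow_pos_of_pos hc ((n : ℝ) - α)
  have hts := Real.rpow_pos_of_pos ht ((n : ℝ) - α)
  rw [kernel_smul α Ω ht, kernel, Real.norm_eq_abs, abs_div, abs_div, hn, abs_of_pos hcs,
    abs_of_pos hts, Real.inv_rpow hc.le]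
  calc _ ≤ B / Real.cosh ((2 * k + 0) * h) ^ ((n : ℝ) - α) / t ^ ((n : ℝ) - α) := by
        gcongr; simpa only [hn] using hB _ h0
    _ = _ := by rw [div_div, mul_comm, ← div_div]; rfl

/-! ### The atomic measure and its copies at a cube -/

/-- The measure `∑ⱼ vⱼ^(n-α) δ_{yⱼ}` with atoms `yⱼ = atomPoint e₁ e₂ R h j` at the heights `vⱼ`. -/
def atomicMeasure (α : ℝ) (e₁ e₂ : EuclideanSpace ℝ (Fin n)) (R h : ℝ) :
    Measure (EuclideanSpace ℝ (Fin n)) :=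
  Measure.sum fun j : ℤ =>
    ENNReal.ofReal (atomHeight R h j ^ ((n : ℝ) - α)) • Measure.dirac (atomPoint e₁ e₂ R h j)

theorem isFiniteMeasure_atomicMeasure {α : ℝ} (hα : α < n) (e₁ e₂ : EuclideanSpace ℝ (Fin n))
    {R h : ℝ} (hR : 0 < R) (hh : 0 < h) : IsFiniteMeasure (atomicMeasure α e₁ e₂ R h) := by
  refine ⟨?_⟩
  rw [atomicMeasure, Measure.sum_apply _ MeasurableSet.univ]
  simpa using (summable_atomHeight_rpow (sub_pos.2 hα) hR hh).tsum_ofReal_lt_top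

theorem Cube.place_atomicMeasure (J : Cube n) (α : ℝ) (e₁ e₂ : EuclideanSpace ℝ (Fin n))
    (R h : ℝ) :
    J.place (atomicMeasure α e₁ e₂ R h) = Measure.sum fun j : ℤ =>
      ENNReal.ofReal (atomHeight R h j ^ ((n : ℝ) - α)) •
        Measure.dirac (J.center + J.side • atomPoint e₁ e₂ R h j) := by
  have hm : Measurable fun y : EuclideanSpace ℝ (Fin n) => J.center + J.side • y := by fun_prop
  rw [Cube.place, atomicMeasure, Measure.map_sum hm.aemeasurable]
  simp_rw [Measure.map_smul, Measure.map_dirac' hm]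

theorem Cube.norm_sub_center_le (J : Cube n) {γ : ℝ} (hγ : 0 ≤ γ)
    {x : EuclideanSpace ℝ (Fin n)} (hx : x ∈ J.dilate γ) :
    ‖x - J.center‖ ≤ √n * (γ * J.side / 2) := by
  have hb : 0 ≤ γ * J.side / 2 := by have := J.side_pos; positivity
  refine (sq_le_sq₀ (norm_nonneg _) (by positivity)).1 ?_
  rw [← J.axes.sum_sq_norm_inner_right, mul_pow, Real.sq_sqrt n.cast_nonneg]
  calc ∑ i, ‖inner ℝ (J.axes i) (x - J.center)‖ ^ 2
      ≤ ∑ _i : Fin n, (γ * J.side / 2) ^ 2 := by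
        gcongr with i
        exact hx i
    _ = n * (γ * J.side / 2) ^ 2 := by simp

theorem Cube.add_smul_mem_carrier (J : Cube n) {e : EuclideanSpace ℝ (Fin n)} (he : ‖e‖ = 1)
    {t : ℝ} (ht : |t| ≤ 1 / 2) : J.center + J.side • t • e ∈ J.carrier := by
  intro i
  have hs := J.side_pos
  have hi : |inner ℝ (J.axes i) e| ≤ 1 := by
    simpa [he] using abs_real_inner_le_norm (J.axes i) e
  rw [add_sub_cancel_left, inner_smul_right, inner_smul_right, abs_mul, abs_mul, abs_of_pos hs]
  have : |t| * |inner ℝ (J.axes i) e| ≤ 1 / 2 * 1 := by gcongr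
  nlinarith

theorem Cube.support_place_atomicMeasure_subset (J : Cube n) (α : ℝ)
    {e₁ e₂ : EuclideanSpace ℝ (Fin n)} (h₁ : ‖e₁‖ = 1) (h₂ : ‖e₂‖ = 1) (h₁₂ : inner ℝ e₁ e₂ = 0)
    {R h γ : ℝ} (hRh : 2 * R * Real.sinh h = 1) (hγ : 0 ≤ γ) (hR : √n * (γ / 2) < R) :
    (J.place (atomicMeasure α e₁ e₂ R h)).support ⊆ (J.dilate γ)ᶜ := by
  intro x hx hxJ
  refine Measure.notMem_support_iff_exists.2
    -- This open ball contains the dilate, whose half-diagonal is `√n γ/2` sides, and carries no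
    -- atom.
    ⟨Metric.ball J.center (J.side * R), Metric.isOpen_ball.mem_nhds ?_, ?_⟩ hx
  · rw [mem_ball_iff_norm]
    refine (J.norm_sub_center_le hγ hxJ).trans_lt ?_
    have := mul_lt_mul_of_pos_left hR J.side_pos
    linarith
  · rw [J.place_atomicMeasure, Measure.sum_apply _ Metric.isOpen_ball.measurableSet,
      ENNReal.tsum_eq_zero]
    intro j
    have hj : J.center + J.side • atomPoint e₁ e₂ R h j ∉ Metric.ball J.center (J.side * R) := by
      rw [mem_ball_iff_norm, add_sub_cancel_left, norm_smul, Real.norm_of_nonneg J.side_pos.le,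
        not_lt]
      exact mul_le_mul_of_nonneg_left (le_norm_atomPoint h₁ h₂ h₁₂ hRh j) J.side_pos.le
    simp [Measure.dirac_apply' _ Metric.isOpen_ball.measurableSet, hj]

/-! ### Equality of the two potentials -/

/-- If `p` sees the `j`-th atom at distance `vⱼ` times the length of `slopeVector e₁ e₂ h (σ j)`,
for a permutation `σ` of the indices, then the potential of the atomic measure at the corresponding
point of the cube is a sum that does not depend on `p` and `σ`. -/
theorem integral_kernel_place_atomicMeasure (J : Cube n) {α : ℝ} (hα : α < n)
    {Ω : EuclideanSpace ℝ (Fin n) → ℝ} (hΩ : SmoothOnSphere Ω)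
    {e₁ e₂ : EuclideanSpace ℝ (Fin n)} (h₁ : ‖e₁‖ = 1) (h₂ : ‖e₂‖ = 1) (h₁₂ : inner ℝ e₁ e₂ = 0)
    {R h : ℝ} (hR : 0 < R) (hh : 0 < h) (p : EuclideanSpace ℝ (Fin n)) (σ : ℤ ≃ ℤ)
    (hp : ∀ j, p - atomPoint e₁ e₂ R h j = -(atomHeight R h j • slopeVector e₁ e₂ h (σ j))) :
    ∫ y, kernel α Ω (J.center + J.side • p - y) ∂(J.place (atomicMeasure α e₁ e₂ R h)) =
      ∑' k : ℤ, kernel α Ω (J.side • -slopeVector e₁ e₂ h k) := by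
  have hval : ∀ j : ℤ, atomHeight R h j ^ ((n : ℝ) - α) *
      kernel α Ω (J.center + J.side • p - (J.center + J.side • atomPoint e₁ e₂ R h j)) =
      kernel α Ω (J.side • -slopeVector e₁ e₂ h (σ j)) := by
    intro j
    have hv := atomHeight_pos hR h j
    rw [add_sub_add_left_eq_sub, ← smul_sub, hp, ← smul_neg, smul_comm, kernel_smul _ _ hv,
      mul_div_cancel₀ _ (Real.rpow_pos_of_pos hv _).ne']
  have hsum := σ.summable_iff.2
    (summable_kernel_slopeVector hα hΩ h₁ h₂ h₁₂ hh J.side_pos)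
  have hw : ∀ j, (ENNReal.ofReal (atomHeight R h j ^ ((n : ℝ) - α))).toReal =
      atomHeight R h j ^ ((n : ℝ) - α) := fun j =>
    ENNReal.toReal_ofReal (Real.rpow_nonneg (atomHeight_pos hR h j).le _)
  -- Absolute convergence allows the integral to be evaluated atom by atom.
  have hint : Integrable (fun y => kernel α Ω (J.center + J.side • p - y))
      (J.place (atomicMeasure α e₁ e₂ R h)) := by
    rw [J.place_atomicMeasure]
    refine integrable_sum_dirac (fun j => ENNReal.ofReal_ne_top) (hsum.norm.congr fun j => ?_)
    rw [hw, Function.comp_apply, ← hval, norm_mul,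
      Real.norm_of_nonneg (Real.rpow_nonneg (atomHeight_pos hR h j).le _)]
  rw [J.place_atomicMeasure] at hint ⊢
  rw [integral_sum_measure hint,
    ← σ.tsum_eq fun k => kernel α Ω (J.side • -slopeVector e₁ e₂ h k)]
  refine tsum_congr fun j => ?_
  rw [integral_smul_measure, integral_dirac, hw, smul_eq_mul, hval]

theorem transform_place_atomicMeasure_eq (J : Cube n) {α : ℝ} (hα : α < n) {N : ℕ}
    {Ω : Fin N → EuclideanSpace ℝ (Fin n) → ℝ} (hΩ : ∀ l, SmoothOnSphere (Ω l))
    {e₁ e₂ : EuclideanSpace ℝ (Fin n)} (h₁ : ‖e₁‖ = 1) (h₂ : ‖e₂‖ = 1) (h₁₂ : inner ℝ e₁ e₂ = 0)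
    {R h : ℝ} (hR : 0 < R) (hh : 0 < h) (hRh : 2 * R * Real.sinh h = 1) :
    transform α Ω (J.place (atomicMeasure α e₁ e₂ R h))
        (J.center + J.side • (1 / 2 : ℝ) • e₁) =
      transform α Ω (J.place (atomicMeasure α e₁ e₂ R h))
        (J.center + J.side • (-(1 / 2) : ℝ) • e₁) := by
  simp only [transform]
  congr 1
  funext l
  rw [integral_kernel_place_atomicMeasure J hα (hΩ l) h₁ h₂ h₁₂ hR hh _ (Equiv.refl ℤ)
      fun j => half_sub_atomPoint e₁ e₂ R h j,
    -- Seen from `-e₁/2`, the `j`-th atom has slope index `j + 1`.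
    integral_kernel_place_atomicMeasure J hα (hΩ l) h₁ h₂ h₁₂ hR hh _ (Equiv.addRight 1)
      fun j => neg_half_sub_atomPoint e₁ e₂ hRh j]

/-! ### Failure of reversal for two point masses -/

theorem poisson_place_atomicMeasure_ne_zero (J : Cube n) (α : ℝ)
    (e₁ e₂ : EuclideanSpace ℝ (Fin n)) {R : ℝ} (hR : 0 < R) (h : ℝ) :
    poisson α J (J.place (atomicMeasure α e₁ e₂ R h)) ≠ 0 := by
  rw [poisson, J.place_atomicMeasure, lintegral_sum_measure]
  intro h0
  have := ENNReal.tsum_eq_zero.1 h0 0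
  rw [lintegral_smul_measure, lintegral_dirac, smul_eq_mul, mul_eq_zero, ENNReal.ofReal_eq_zero,
    ENNReal.ofReal_eq_zero] at this
  have hs := J.side_pos
  have hv := Real.rpow_pos_of_pos (atomHeight_pos hR h 0) ((n : ℝ) - α)
  rcases this with h' | h'
  · exact absurd h' hv.not_ge
  · refine absurd h' (not_le.2 (div_pos hs (Real.rpow_pos_of_pos ?_ _)))
    positivity

/-- The average over `J` of a function against the sum of unit masses at two points of `J`. -/
theorem setLAverage_dirac_add_dirac (J : Cube n) {p q : EuclideanSpace ℝ (Fin n)}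
    (hp : p ∈ J.carrier) (hq : q ∈ J.carrier) (f : EuclideanSpace ℝ (Fin n) → ℝ≥0∞) :
    ⨍⁻ x in J.carrier, f x ∂(Measure.dirac p + Measure.dirac q) = (f p + f q) / 2 := by
  classical
  rw [setLAverage_eq, Measure.restrict_add, restrict_dirac, restrict_dirac,
    if_pos hp, if_pos hq, lintegral_add_measure, lintegral_dirac, lintegral_dirac,
    Measure.add_apply, Measure.dirac_apply_of_mem hp, Measure.dirac_apply_of_mem hq,
    one_add_one_eq_two]

theorem not_reversalInequality_dirac_add_dirac (J : Cube n) {α : ℝ} (C₀ : ℝ) {N : ℕ}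
    {Ω : Fin N → EuclideanSpace ℝ (Fin n) → ℝ} {p q : EuclideanSpace ℝ (Fin n)}
    (hp : p ∈ J.carrier) (hq : q ∈ J.carrier) (hpq : p ≠ q)
    {μ : Measure (EuclideanSpace ℝ (Fin n))} (hμ : poisson α J μ ≠ 0)
    (hT : transform α Ω μ p = transform α Ω μ q) :
    ¬ ReversalInequality α C₀ J Ω (Measure.dirac p + Measure.dirac q) μ := by
  have hE : energySq J (Measure.dirac p + Measure.dirac q) ≠ 0 := by
    have : J.side ≠ 0 := J.side_pos.ne'
    simp only [energySq, setLAverage_dirac_add_dirac J hp hq]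
    simp [sub_eq_zero, hpq, hpq.symm, this]
  simp only [ReversalInequality, setLAverage_dirac_add_dirac J hp hq, hT, sub_self]
  simp [hE, hμ]

end EnergyReversal

end


theorem corollary3 (n : ℕ) (hn : 2 ≤ n) (α : ℝ) (hα0 : 0 ≤ α) (hαn : α < n) :
    ∃ ν : ℝ → Measure (EuclideanSpace ℝ (Fin n)),
      (∀ γ : ℝ, 2 < γ → IsFiniteMeasure (ν γ)) ∧
      ∀ J : EnergyReversal.Cube n,
        (∀ γ : ℝ, 2 < γ → (J.place (ν γ)).support ⊆ (J.dilate γ)ᶜ) ∧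
        (∀ C₀ : ℝ, 0 < C₀ → ∃ γ₀ : ℝ, 2 < γ₀ ∧ ∀ γ : ℝ, γ₀ ≤ γ →
          ∀ (N : ℕ) (Ω : Fin N → EuclideanSpace ℝ (Fin n) → ℝ),
            (∀ l, EnergyReversal.SmoothOnSphere (Ω l)) →
            (∀ l, EnergyReversal.VanishesOnGreatCircles (Ω l) ∨
              EnergyReversal.OddKernel α (Ω l)) →
            ∃ ω : Measure (EuclideanSpace ℝ (Fin n)),
              IsFiniteMeasure ω ∧ 0 < ω J.carrier ∧
                ¬ EnergyReversal.ReversalInequality α C₀ J Ω ω (J.place (ν γ))) ∧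
        (∃ ω : Measure (EuclideanSpace ℝ (Fin n)),
          IsFiniteMeasure ω ∧ 0 < ω J.carrier ∧
          ∀ C₀ : ℝ, 0 < C₀ →
          ∀ (N : ℕ) (Ω : Fin N → EuclideanSpace ℝ (Fin n) → ℝ),
            (∀ l, EnergyReversal.SmoothOnSphere (Ω l)) →
            (∀ l, EnergyReversal.VanishesOnGreatCircles (Ω l) ∨
              EnergyReversal.OddKernel α (Ω l)) →
            ∃ γ₀ : ℝ, 2 < γ₀ ∧ ∀ γ : ℝ, γ₀ ≤ γ →
              ¬ EnergyReversal.ReversalInequality α C₀ J Ω ω (J.place (ν γ))) := by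
  have h_arsinh : ∀ R : ℝ, 0 < R → 0 < Real.arsinh (1 / (2 * R)) := fun R hR =>
    Real.arsinh_pos_iff.2 (by positivity)
  have hRh : ∀ R : ℝ, 0 < R → 2 * R * Real.sinh (Real.arsinh (1 / (2 * R))) = 1 := by
    intro R hR
    rw [Real.sinh_arsinh]
    field_simp
  have hn0 : 0 < √(n : ℝ) := Real.sqrt_pos.2 (by exact_mod_cast (by omega : 0 < n))
  have hRpos : ∀ γ : ℝ, 2 < γ → 0 < √n * γ := fun γ hγ => mul_pos hn0 (by linarith)
  let e₁ : EuclideanSpace ℝ (Fin n) := EuclideanSpace.single ⟨0, by omega⟩ 1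
  let e₂ : EuclideanSpace ℝ (Fin n) := EuclideanSpace.single ⟨1, by omega⟩ 1
  have h₁ : ‖e₁‖ = 1 := by simp [e₁]
  have h₂ : ‖e₂‖ = 1 := by simp [e₂]
  have h₁₂ : inner ℝ e₁ e₂ = 0 := by simp [e₁, e₂, EuclideanSpace.inner_single_left]
  -- `R = √n γ` exceeds the half-diagonal of `γJ` in units of the side, and `h` is fixed by `2R sinh
  -- h = 1`.
  refine ⟨fun γ => EnergyReversal.atomicMeasure α e₁ e₂ (√n * γ)
    (Real.arsinh (1 / (2 * (√n * γ)))), fun γ hγ => ?_, fun J => ?_⟩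
  · exact EnergyReversal.isFiniteMeasure_atomicMeasure hαn e₁ e₂ (hRpos γ hγ)
      (h_arsinh _ (hRpos γ hγ))
  set p := J.center + J.side • (1 / 2 : ℝ) • e₁ with hp_def
  set q := J.center + J.side • (-(1 / 2) : ℝ) • e₁ with hq_def
  have hp : p ∈ J.carrier := J.add_smul_mem_carrier h₁ (by norm_num [abs_of_pos])
  have hq : q ∈ J.carrier := J.add_smul_mem_carrier h₁ (by norm_num [abs_of_pos])
  have hpq : p ≠ q := by
    intro h
    have h' : J.side • e₁ = 0 := by
      linear_combination (norm := module) h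
    rw [smul_eq_zero] at h'
    rcases h' with h' | h'
    · exact J.side_pos.ne' h'
    · simp [h'] at h₁
  have hfail : ∀ γ : ℝ, 2 < γ → ∀ (C₀ : ℝ) (N : ℕ) (Ω : Fin N → EuclideanSpace ℝ (Fin n) → ℝ),
      (∀ l, EnergyReversal.SmoothOnSphere (Ω l)) →
      ¬ EnergyReversal.ReversalInequality α C₀ J Ω (Measure.dirac p + Measure.dirac q)
        (J.place (EnergyReversal.atomicMeasure α e₁ e₂ (√n * γ)
          (Real.arsinh (1 / (2 * (√n * γ)))))) := fun γ hγ C₀ N Ω hΩ =>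
    EnergyReversal.not_reversalInequality_dirac_add_dirac J C₀ hp hq hpq
      (EnergyReversal.poisson_place_atomicMeasure_ne_zero J α e₁ e₂ (hRpos γ hγ) _)
      (EnergyReversal.transform_place_atomicMeasure_eq J hαn hΩ h₁ h₂ h₁₂ (hRpos γ hγ)
        (h_arsinh _ (hRpos γ hγ)) (hRh _ (hRpos γ hγ)))
  have hω : 0 < (Measure.dirac p + Measure.dirac q) J.carrier := by
    simp [Measure.dirac_apply_of_mem hp]
  -- Reversal fails for all `γ > 2` with the same `ω`, so any threshold above 2 serves.
  refine ⟨fun γ hγ => ?_, fun C₀ _ => ⟨3, by norm_num, fun γ hγ N Ω hΩ _ =>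
    ⟨_, inferInstance, hω, hfail γ (by linarith) C₀ N Ω hΩ⟩⟩,
    _, inferInstance, hω, fun C₀ _ N Ω hΩ _ =>
      ⟨3, by norm_num, fun γ hγ => hfail γ (by linarith) C₀ N Ω hΩ⟩⟩
  refine J.support_place_atomicMeasure_subset α h₁ h₂ h₁₂ (hRh _ (hRpos γ hγ)) (by linarith) ?_
  exact mul_lt_mul_of_pos_left (by linarith) hn0
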